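/- Let $N$ be a natural number and consider the polynomial ring $\mathbb{C}[u_1,\dots,u_N,v_1,\dots,v_N,s]$. For exponent vectors $\alpha=(\alpha_1,\alpha_2,\alpha_3)$ and $\beta=(\beta_1,\beta_2,\beta_3)$ in $\mathbb{N}^N\times\mathbb{N}^N\times\mathbb{N}$, put $u^{\alpha_1}v^{\alpha_2}s^{\alpha_3}\preccurlyeq u^{\beta_1}v^{\beta_2}s^{\beta_3}$ if $\alpha=\beta$ or the first nonzero entry of $M(\alpha-\beta)$ is negative, where $M$ is the anti-diagonal $(2N+1)\times(2N+1)$ matrix with $M_{1,2N+1}=1$, $M_{k,2N+2-k}=-1$ for $k=2,\dots,2N+1$, and all other entries $0$. The leading monomial $\mathrm{init}(p)$ of a nonzero polynomial $p$ is the $\preccurlyeq$-smallest monomial that occurs in $p$ with nonzero coefficient. For a subalgebra $S$, its initial algebra is $S_{\mathrm{in}}=\mathrm{Span}_{\mathbb{C}}\{\mathrm{init}(p)\mid p\in S,\ p\neq 0\}$, and a subset of $S$ is a Khovanskii (SAGBI) basis of $S$ if the leading monomials of its elements generate $S_{\mathrm{in}}$ as a $\mathbb{C}$-algebra. Let $\theta_0=1$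 and, for $i=1,\dots,N$, $$\theta_{i,1}=u_i,\quad \theta_{i,2}=v_i,\quad \theta_{i,3}=(u_i^2+v_i^2)u_i,\quad \theta_{i,4}=(u_i^2+v_i^2)v_i,$$ and let $S_\phi$ be the $\mathbb{C}$-algebra generated by $s\theta_0$ and all $s\theta_{i,j}$ with $1\le i\le N$, $1\le j\le 4$. Then the polynomials $s\theta_0$ and $s\theta_{i,j}$ ($1\le i\le N$, $1\le j\le 4$) form a Khovanskii basis of $S_\phi$ with respect to $\preccurlyeq$. -/

import Mathlib

open MvPolynomial

namespace Oscillator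

/-- The position of `u_i` in the list of variables `u_1, …, u_N, v_1, …, v_N, s`. -/
def uIdx {N : ℕ} (i : Fin N) : Fin (2 * N + 1) := ⟨i.val, by omega⟩

/-- The position of `v_i` in the list of variables `u_1, …, u_N, v_1, …, v_N, s`. -/
def vIdx {N : ℕ} (i : Fin N) : Fin (2 * N + 1) := ⟨N + i.val, by omega⟩

/-- The position of `s` in the list of variables `u_1, …, u_N, v_1, …, v_N, s`. -/
def sIdx (N : ℕ) : Fin (2 * N + 1) := Fin.last (2 * N)

/-- The polynomial ring `ℂ[u_1, …, u_N, v_1, …, v_N, s]`. -/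
abbrev PolyRing (N : ℕ) : Type := MvPolynomial (Fin (2 * N + 1)) ℂ

/-- The variable `u_i`. -/
noncomputable def u {N : ℕ} (i : Fin N) : PolyRing N := X (uIdx i)

/-- The variable `v_i`. -/
noncomputable def v {N : ℕ} (i : Fin N) : PolyRing N := X (vIdx i)

/-- The variable `s`. -/
noncomputable def s (N : ℕ) : PolyRing N := X (sIdx N)

/-- The polynomials `θ_{i,1} = u_i`, `θ_{i,2} = v_i`, `θ_{i,3} = (u_i² + v_i²) u_i`,
`θ_{i,4} = (u_i² + v_i²) v_i`; the second index is shifted to start from `0`. -/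
noncomputable def theta {N : ℕ} (i : Fin N) : Fin 4 → PolyRing N :=
  ![u i, v i, (u i ^ 2 + v i ^ 2) * u i, (u i ^ 2 + v i ^ 2) * v i]

/-- The `4N + 1` polynomials `s θ_0` (where `θ_0 = 1`) and `s θ_{i,j}`. -/
def generators (N : ℕ) : Set (PolyRing N) :=
  insert (s N * 1) (Set.range fun ij : Fin N × Fin 4 => s N * theta ij.1 ij.2)

/-- The algebra `S_φ` generated by `s θ_0` and all `s θ_{i,j}`. -/
noncomputable def Sphi (N : ℕ) : Subalgebra ℂ (PolyRing N) :=
  Algebra.adjoin ℂ (generators N)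

/-- The anti-diagonal matrix `M` with entry `1` in the first row and `-1` in all other rows. -/
def orderMatrix (N : ℕ) : Matrix (Fin (2 * N + 1)) (Fin (2 * N + 1)) ℤ :=
  Matrix.of fun i j => if j = Fin.rev i then (if i = 0 then 1 else -1) else 0

/-- The vector `M · (α - β)`, where `α` and `β` are exponent vectors, taken in `ℤ^(2N+1)`. -/
def weightDiff (N : ℕ) (α β : Fin (2 * N + 1) →₀ ℕ) : Fin (2 * N + 1) → ℤ :=
  (orderMatrix N).mulVec fun j => (α j : ℤ) - (β j : ℤ)

/-- The monomial order `α ≼ β`: either `α = β`, or the first nonzero entry of `M · (α - β)` is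
negative. -/
def monLE (N : ℕ) (α β : Fin (2 * N + 1) →₀ ℕ) : Prop :=
  α = β ∨ ∃ k, (∀ l, l < k → weightDiff N α β l = 0) ∧ weightDiff N α β k < 0

/-- `α` is the exponent of the leading monomial of `p` with respect to the order `r` on exponents:
among the monomials that occur in `p` with nonzero coefficient, it is the one that precedes all
others. The leading monomial of `p` is its `r`-smallest monomial. The zero polynomial has none. -/
def IsLeadingExponent {σ : Type*} (r : (σ →₀ ℕ) → (σ →₀ ℕ) → Prop)
    (p : MvPolynomial σ ℂ) (α : σ →₀ ℕ) : Prop :=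
  α ∈ p.support ∧ ∀ β ∈ p.support, r α β

/-- The set of leading monomials of the nonzero elements of a set of polynomials. -/
def leadingMonomials {σ : Type*} (r : (σ →₀ ℕ) → (σ →₀ ℕ) → Prop)
    (B : Set (MvPolynomial σ ℂ)) : Set (MvPolynomial σ ℂ) :=
  {m | ∃ p ∈ B, ∃ α, IsLeadingExponent r p α ∧ m = monomial α 1}

/-- The initial algebra of `S`: the `ℂ`-span of the leading monomials of all elements of `S`. -/
noncomputable def initialAlgebra {σ : Type*} (r : (σ →₀ ℕ) → (σ →₀ ℕ) → Prop)
    (S : Subalgebra ℂ (MvPolynomial σ ℂ)) : Submodule ℂ (MvPolynomial σ ℂ) :=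
  Submodule.span ℂ (leadingMonomials r (S : Set (MvPolynomial σ ℂ)))

/-- `B` is a Khovanskii (SAGBI) basis of `S`: it is a subset of `S`, and the leading monomials of
its elements generate the initial algebra of `S` as an algebra. -/
def IsKhovanskiiBasis {σ : Type*} (r : (σ →₀ ℕ) → (σ →₀ ℕ) → Prop)
    (B : Set (MvPolynomial σ ℂ)) (S : Subalgebra ℂ (MvPolynomial σ ℂ)) : Prop :=
  B ⊆ (S : Set (MvPolynomial σ ℂ)) ∧
    Subalgebra.toSubmodule (Algebra.adjoin ℂ (leadingMonomials r B)) = initialAlgebra r S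

/-! The relation `monLE` is a total order compatible with multiplication of monomials, so every
nonzero polynomial has exactly one leading monomial. -/

theorem weightDiff_apply (N : ℕ) (α β : Fin (2 * N + 1) →₀ ℕ) (k : Fin (2 * N + 1)) :
    weightDiff N α β k =
      (if k = 0 then 1 else -1) * ((α (Fin.rev k) : ℤ) - (β (Fin.rev k) : ℤ)) := by
  simp [weightDiff, orderMatrix, Matrix.mulVec, dotProduct, ite_mul]

theorem weightDiff_swap (N : ℕ) (α β : Fin (2 * N + 1) →₀ ℕ) (k : Fin (2 * N + 1)) :
    weightDiff N β α k = - weightDiff N α β k := by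
  rw [weightDiff_apply, weightDiff_apply]; ring

theorem monLE_add_right (N : ℕ) (α β γ : Fin (2 * N + 1) →₀ ℕ) :
    monLE N (α + γ) (β + γ) ↔ monLE N α β := by
  simp [monLE, weightDiff_apply]

theorem monLE_total (N : ℕ) (α β : Fin (2 * N + 1) →₀ ℕ) : monLE N α β ∨ monLE N β α := by
  by_cases h : ∃ k, weightDiff N α β k ≠ 0
  · obtain ⟨k, hk, hmin⟩ := WellFounded.has_min (wellFounded_lt (α := Fin (2 * N + 1)))
      {k | weightDiff N α β k ≠ 0} h
    have h0 : ∀ l, l < k → weightDiff N α β l = 0 := fun l hl => by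
      by_contra hne
      exact hmin l hne hl
    rcases lt_or_gt_of_ne hk with hlt | hgt
    · exact Or.inl (Or.inr ⟨k, h0, hlt⟩)
    · refine Or.inr (Or.inr ⟨k, fun l hl => ?_, ?_⟩)
      · rw [weightDiff_swap, h0 l hl, neg_zero]
      · rw [weightDiff_swap]; omega
  · push Not at h
    refine Or.inl (Or.inl (Finsupp.ext fun j => ?_))
    have := h (Fin.rev j)
    rw [weightDiff_apply, Fin.rev_rev] at this
    split_ifs at this <;> omega

theorem monLE_antisymm (N : ℕ) (α β : Fin (2 * N + 1) →₀ ℕ)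
    (h₁ : monLE N α β) (h₂ : monLE N β α) : α = β := by
  rcases h₁ with h | ⟨k, hk, hk'⟩
  · exact h
  rcases h₂ with h | ⟨l, hl, hl'⟩
  · exact h.symm
  rw [weightDiff_swap] at hl'
  rcases lt_trichotomy k l with h | h | h
  · have := hl k h
    rw [weightDiff_swap] at this
    omega
  · subst h; omega
  · have := hk l h
    omega

theorem monLE_trans (N : ℕ) (α β γ : Fin (2 * N + 1) →₀ ℕ)
    (h₁ : monLE N α β) (h₂ : monLE N β γ) : monLE N α γ := by
  have hadd : ∀ k, weightDiff N α γ k = weightDiff N α β k + weightDiff N β γ k := fun k => by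
    simp only [weightDiff_apply]; ring
  rcases h₁ with h | ⟨k, hk, hk'⟩
  · exact h ▸ h₂
  rcases h₂ with h | ⟨l, hl, hl'⟩
  · exact h ▸ Or.inr ⟨k, hk, hk'⟩
  refine Or.inr ⟨min k l, fun j hj => ?_, ?_⟩
  · rw [hadd, hk j (lt_of_lt_of_le hj (min_le_left _ _)),
      hl j (lt_of_lt_of_le hj (min_le_right _ _)), add_zero]
  · rw [hadd]
    rcases lt_trichotomy k l with h | h | h
    · rw [min_eq_left h.le, hl k h]; omega
    · subst h; rw [min_self]; omega
    · rw [min_eq_right h.le, hk l h]; omega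

theorem existsUnique_isLeadingExponent (N : ℕ) (p : PolyRing N) (hp : p ≠ 0) :
    ∃! α, IsLeadingExponent (monLE N) p α := by
  have key : ∀ t : Finset (Fin (2 * N + 1) →₀ ℕ), t.Nonempty →
      ∃ α ∈ t, ∀ β ∈ t, monLE N α β := by
    intro t ht
    induction ht using Finset.Nonempty.cons_induction with
    | singleton a => exact ⟨a, by simp, by simp [monLE]⟩
    | cons a t ha ht ih =>
      obtain ⟨α, hα, hmin⟩ := ih
      rcases monLE_total N a α with h | h
      · refine ⟨a, by simp, fun β hβ => ?_⟩
        rcases Finset.mem_cons.1 hβ with rfl | hβ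
        · exact Or.inl rfl
        · exact monLE_trans N _ _ _ h (hmin β hβ)
      · refine ⟨α, by simp [hα], fun β hβ => ?_⟩
        rcases Finset.mem_cons.1 hβ with rfl | hβ
        · exact h
        · exact hmin β hβ
  obtain ⟨α, hα, hmin⟩ := key p.support (MvPolynomial.support_nonempty.2 hp)
  exact ⟨α, ⟨hα, hmin⟩, fun β hβ => monLE_antisymm N _ _ (hβ.2 α hα) (hmin β hβ.1)⟩

end Oscillator

/-! The order looks at `s` first, then prefers high powers of the `v` variables, so `u_i² + v_i²`
has leading monomial `v_i²`. Leading exponents add under multiplication, which gives one inclusion.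
For the other, write `y_j = s θ_{i,j}` and `y_0 = s`. The relations `y_1 y_4 = y_2 y_3`, `y_1 y_2² =
y_0² y_3 - y_1³`, `y_2³ = y_0² y_4 - y_1² y_2` rewrite every product of generators as a combination
of normal ones (`genProd_mem_span_normal`). Normal products have pairwise distinct leading exponents
(`IsNormal.genExp_injective`), so leading terms cannot all cancel in a combination
(`exists_eq_of_mem_span`). Each leading monomial of `Sphi N` is thus a product of leading monomials
of generators. -/

namespace Oscillator

open Finset

/-! ### Leading exponents of products and linear combinations -/

section LeadingExponent

variable {N : ℕ} {p q : PolyRing N} {α β : Fin (2 * N + 1) →₀ ℕ}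

theorem monLE_refl (N : ℕ) (α : Fin (2 * N + 1) →₀ ℕ) : monLE N α α := Or.inl rfl

theorem monLE_add {α α' β β' : Fin (2 * N + 1) →₀ ℕ} (h : monLE N α α') (h' : monLE N β β') :
    monLE N (α + β) (α' + β') := by
  refine monLE_trans N _ _ _ ((monLE_add_right N _ _ β).2 h) ?_
  rw [add_comm α', add_comm α']
  exact (monLE_add_right N _ _ α').2 h'

/-- This excludes cancellation at the leading exponent of a product: only one pair of terms
contributes there. -/
theorem eq_of_add_eq_add_of_monLE {α α' β β' : Fin (2 * N + 1) →₀ ℕ} (h : monLE N α α')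
    (h' : monLE N β β') (e : α' + β' = α + β) : α' = α ∧ β' = β := by
  have h₁ : monLE N α' α := by
    rw [← monLE_add_right N _ _ β', e]
    exact monLE_add (monLE_refl N α) h'
  have h₂ := monLE_antisymm N _ _ h h₁
  subst h₂
  exact ⟨rfl, add_left_cancel e⟩

theorem IsLeadingExponent.eq (h : IsLeadingExponent (monLE N) p α)
    (h' : IsLeadingExponent (monLE N) p β) : α = β :=
  monLE_antisymm N _ _ (h.2 _ h'.1) (h'.2 _ h.1)

theorem IsLeadingExponent.mul (hp : IsLeadingExponent (monLE N) p α)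
    (hq : IsLeadingExponent (monLE N) q β) : IsLeadingExponent (monLE N) (p * q) (α + β) := by
  refine ⟨?_, fun γ hγ => ?_⟩
  · have hc : coeff (α + β) (p * q) = coeff α p * coeff β q := by
      rw [coeff_mul]
      refine Finset.sum_eq_single (α, β) (fun x hx hne => ?_) (fun h => ?_)
      · by_contra hmul
        have h₁ := hp.2 x.1 (mem_support_iff.2 (left_ne_zero_of_mul hmul))
        have h₂ := hq.2 x.2 (mem_support_iff.2 (right_ne_zero_of_mul hmul))
        rw [HasAntidiagonal.mem_antidiagonal] at hx
        obtain ⟨e₁, e₂⟩ := eq_of_add_eq_add_of_monLE h₁ h₂ hx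
        exact hne (Prod.ext e₁ e₂)
      · simp at h
    rw [mem_support_iff, hc]
    exact mul_ne_zero (mem_support_iff.1 hp.1) (mem_support_iff.1 hq.1)
  · classical
    obtain ⟨a, ha, b, hb, rfl⟩ := Finset.mem_add.1 (support_mul p q hγ)
    exact monLE_add (hp.2 a ha) (hq.2 b hb)

theorem isLeadingExponent_monomial (α : Fin (2 * N + 1) →₀ ℕ) :
    IsLeadingExponent (monLE N) (monomial α 1) α := by
  simp [IsLeadingExponent, support_monomial, monLE_refl]

theorem isLeadingExponent_one : IsLeadingExponent (monLE N) (1 : PolyRing N) 0 :=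
  isLeadingExponent_monomial 0

theorem isLeadingExponent_X (i : Fin (2 * N + 1)) :
    IsLeadingExponent (monLE N) (X i : PolyRing N) (Finsupp.single i 1) :=
  isLeadingExponent_monomial _

theorem IsLeadingExponent.pow (hp : IsLeadingExponent (monLE N) p α) (n : ℕ) :
    IsLeadingExponent (monLE N) (p ^ n) (n • α) := by
  induction n with
  | zero => simpa using isLeadingExponent_one
  | succ n ih => rw [pow_succ, succ_nsmul]; exact ih.mul hp

theorem isLeadingExponent_prod {ι : Type*} (t : Finset ι) {f : ι → PolyRing N}
    {a : ι → Fin (2 * N + 1) →₀ ℕ} (h : ∀ i ∈ t, IsLeadingExponent (monLE N) (f i) (a i)) :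
    IsLeadingExponent (monLE N) (∏ i ∈ t, f i) (∑ i ∈ t, a i) := by
  classical
  induction t using Finset.induction_on with
  | empty => simpa using isLeadingExponent_one
  | insert i t hi ih =>
    rw [prod_insert hi, sum_insert hi]
    exact (h i (mem_insert_self i t)).mul (ih fun j hj => h j (mem_insert_of_mem hj))

theorem IsLeadingExponent.coeff_eq_zero (hp : IsLeadingExponent (monLE N) p α)
    (h : monLE N β α) (hne : β ≠ α) : coeff β p = 0 := by
  by_contra hc
  exact hne (monLE_antisymm N _ _ h (hp.2 β (mem_support_iff.2 hc)))

theorem exists_monLE_min (t : Finset (Fin (2 * N + 1) →₀ ℕ)) (ht : t.Nonempty) :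
    ∃ α ∈ t, ∀ β ∈ t, monLE N α β := by
  -- The minimum of `t` is the leading exponent of a polynomial with support `t`.
  obtain ⟨α, hα, -⟩ := existsUnique_isLeadingExponent N (∑ γ ∈ t, monomial γ 1) (by
    classical
    obtain ⟨γ, hγ⟩ := ht
    intro h
    have := congrArg (coeff γ) h
    simp [coeff_sum, coeff_monomial, hγ] at this)
  have hs : (∑ γ ∈ t, monomial γ 1 : PolyRing N).support = t := by
    classical
    ext γ
    simp [coeff_sum, coeff_monomial]
  rw [IsLeadingExponent, hs] at hα
  exact ⟨α, hα⟩

/-- The leading exponent of a linear combination of polynomials with pairwise different leading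
exponents is one of these. -/
theorem exists_eq_of_mem_span {ι : Type*} {f : ι → PolyRing N} {a : ι → Fin (2 * N + 1) →₀ ℕ}
    (hf : ∀ i, IsLeadingExponent (monLE N) (f i) (a i)) (ha : Function.Injective a)
    (hp : p ∈ Submodule.span ℂ (Set.range f)) (hα : IsLeadingExponent (monLE N) p α) :
    ∃ i, α = a i := by
  classical
  obtain ⟨c, rfl⟩ := Finsupp.mem_span_range_iff_exists_finsupp.1 hp
  have hc : c.support.Nonempty := by
    rw [Finsupp.support_nonempty_iff]
    rintro rfl
    simpa using hα.1
  obtain ⟨_, hm, hmin⟩ := exists_monLE_min (N := N) (c.support.image a) (hc.image a)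
  obtain ⟨i, hi, rfl⟩ := mem_image.1 hm
  have hmin' : ∀ j ∈ c.support, monLE N (a i) (a j) := fun j hj =>
    hmin _ (mem_image_of_mem a hj)
  refine ⟨i, hα.eq ⟨?_, fun β hβ => ?_⟩⟩
  -- At the smallest exponent `a i`, injectivity of `a` leaves `f i` as the only contributor.
  · rw [mem_support_iff, Finsupp.sum, coeff_sum, sum_eq_single_of_mem i hi]
    · rw [coeff_smul]
      exact mul_ne_zero (Finsupp.mem_support_iff.1 hi) (mem_support_iff.1 (hf i).1)
    · intro j hj hji
      rw [coeff_smul, (hf j).coeff_eq_zero (hmin' j hj) (fun h => hji (ha h).symm), smul_zero]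
  · rw [mem_support_iff, Finsupp.sum, coeff_sum] at hβ
    obtain ⟨j, hj, hne⟩ := exists_ne_zero_of_sum_ne_zero hβ
    rw [coeff_smul] at hne
    exact monLE_trans N _ _ _ (hmin' j hj)
      ((hf j).2 β (mem_support_iff.2 (right_ne_zero_of_mul hne)))

theorem adjoin_leadingMonomials_le (S : Subalgebra ℂ (PolyRing N)) {B : Set (PolyRing N)}
    (hB : B ⊆ S) :
    Subalgebra.toSubmodule (Algebra.adjoin ℂ (leadingMonomials (monLE N) B)) ≤
      initialAlgebra (monLE N) S := by
  rw [Algebra.adjoin_eq_span]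
  refine Submodule.span_mono fun m hm => ?_
  induction hm using Submonoid.closure_induction with
  | mem x hx =>
    obtain ⟨p, hp, h⟩ := hx
    exact ⟨p, hB hp, h⟩
  | one => exact ⟨1, S.one_mem, 0, isLeadingExponent_one, rfl⟩
  | mul x y _ _ hx hy =>
    obtain ⟨p, hp, α, hα, rfl⟩ := hx
    obtain ⟨q, hq, β, hβ, rfl⟩ := hy
    exact ⟨p * q, S.mul_mem hp hq, α + β, hα.mul hβ, by simp [monomial_mul]⟩

end LeadingExponent

/-! ### Products of generators and their leading exponents -/

section Generators

variable {N : ℕ}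

theorem uIdx_inj {i j : Fin N} : uIdx i = uIdx j ↔ i = j := by
  simp [uIdx, Fin.ext_iff]

theorem vIdx_inj {i j : Fin N} : vIdx i = vIdx j ↔ i = j := by
  simp [vIdx, Fin.ext_iff]

theorem uIdx_ne_vIdx (i j : Fin N) : uIdx i ≠ vIdx j := by
  simp only [uIdx, vIdx, ne_eq, Fin.ext_iff]; omega

theorem uIdx_ne_sIdx (i : Fin N) : uIdx i ≠ sIdx N := by
  simp only [uIdx, sIdx, ne_eq, Fin.ext_iff, Fin.val_last]; omega

theorem vIdx_ne_sIdx (i : Fin N) : vIdx i ≠ sIdx N := by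
  simp only [vIdx, sIdx, ne_eq, Fin.ext_iff, Fin.val_last]; omega

theorem monLE_single_vIdx_single_uIdx (i : Fin N) (n : ℕ) :
    monLE N (Finsupp.single (vIdx i) (n + 1)) (Finsupp.single (uIdx i) (n + 1)) := by
  -- Rows of the matrix scan the variables from last to first, so `v_i` is met before `u_i`, in a
  -- row with entry `-1`.
  refine Or.inr ⟨Fin.rev (vIdx i), fun l hl => ?_, ?_⟩
  · have hl' : vIdx i < Fin.rev l := by rwa [Fin.lt_rev_iff]
    have hu : uIdx i < Fin.rev l := lt_of_le_of_lt (by simp [uIdx, vIdx, Fin.le_def]) hl'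
    rw [weightDiff_apply, Finsupp.single_eq_of_ne hl'.ne', Finsupp.single_eq_of_ne hu.ne']
    simp
  · have h0 : Fin.rev (vIdx i) ≠ 0 := by
      simp only [vIdx, ne_eq, Fin.ext_iff, Fin.val_rev, Fin.val_zero]; omega
    rw [weightDiff_apply, if_neg h0, Fin.rev_rev, Finsupp.single_eq_same,
      Finsupp.single_eq_of_ne (uIdx_ne_vIdx i i).symm]
    push_cast
    omega

theorem isLeadingExponent_sq_add_sq (i : Fin N) :
    IsLeadingExponent (monLE N) (u i ^ 2 + v i ^ 2) (Finsupp.single (vIdx i) 2) := by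
  classical
  have hne : Finsupp.single (uIdx i) 2 ≠ Finsupp.single (vIdx i) 2 := by
    simp [Finsupp.single_eq_single_iff, uIdx_ne_vIdx]
  simp only [IsLeadingExponent, u, v, X_pow_eq_monomial, mem_support_iff, coeff_add,
    coeff_monomial]
  refine ⟨by simp [hne], fun β hβ => ?_⟩
  by_cases h : Finsupp.single (vIdx i) 2 = β
  · exact Or.inl h
  · by_cases h' : Finsupp.single (uIdx i) 2 = β
    · exact h' ▸ monLE_single_vIdx_single_uIdx i 1
    · simp [h, h'] at hβ

/-- The leading exponent of `θ_{i,j}`. -/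
noncomputable def thetaExp (i : Fin N) : Fin 4 → Fin (2 * N + 1) →₀ ℕ :=
  ![Finsupp.single (uIdx i) 1, Finsupp.single (vIdx i) 1,
    Finsupp.single (vIdx i) 2 + Finsupp.single (uIdx i) 1,
    Finsupp.single (vIdx i) 2 + Finsupp.single (vIdx i) 1]

theorem isLeadingExponent_theta (i : Fin N) (j : Fin 4) :
    IsLeadingExponent (monLE N) (theta i j) (thetaExp i j) := by
  fin_cases j
  · exact isLeadingExponent_X _
  · exact isLeadingExponent_X _
  · exact (isLeadingExponent_sq_add_sq i).mul (isLeadingExponent_X _)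
  · exact (isLeadingExponent_sq_add_sq i).mul (isLeadingExponent_X _)

/-- The product of the generators with `s θ_0` to the power `k` and `s θ_{i,j}` to the power
`e i j`. -/
noncomputable def genProd (k : ℕ) (e : Fin N → Fin 4 → ℕ) : PolyRing N :=
  s N ^ k * ∏ i, ∏ j, (s N * theta i j) ^ e i j

/-- The leading exponent of `genProd k e`. -/
noncomputable def genExp (k : ℕ) (e : Fin N → Fin 4 → ℕ) : Fin (2 * N + 1) →₀ ℕ :=
  k • Finsupp.single (sIdx N) 1 +
    ∑ i, ∑ j, e i j • (Finsupp.single (sIdx N) 1 + thetaExp i j)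

theorem isLeadingExponent_genProd (k : ℕ) (e : Fin N → Fin 4 → ℕ) :
    IsLeadingExponent (monLE N) (genProd k e) (genExp k e) :=
  ((isLeadingExponent_X _).pow k).mul <| isLeadingExponent_prod _ fun i _ =>
    isLeadingExponent_prod _ fun j _ =>
      ((isLeadingExponent_X _).mul (isLeadingExponent_theta i j)).pow _

theorem genProd_add (k l : ℕ) (e f : Fin N → Fin 4 → ℕ) :
    genProd (k + l) (e + f) = genProd k e * genProd l f := by
  simp only [genProd, Pi.add_apply, pow_add, prod_mul_distrib]
  ring

theorem genProd_single (k : ℕ) (i : Fin N) (f : Fin 4 → ℕ) :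
    genProd k (Pi.single i f) = s N ^ k * ∏ j, (s N * theta i j) ^ f j := by
  rw [genProd, prod_eq_single i]
  · simp
  · intro i' _ h
    simp [h]
  · simp

theorem exists_eq_genProd {p : PolyRing N} (hp : p ∈ Submonoid.closure (generators N)) :
    ∃ k e, p = genProd k e := by
  induction hp using Submonoid.closure_induction with
  | mem x hx =>
    rcases hx with rfl | ⟨⟨i, j⟩, rfl⟩
    · exact ⟨1, 0, by simp [genProd]⟩
    · refine ⟨0, Pi.single i (Pi.single j 1), ?_⟩
      rw [genProd_single, prod_eq_single j]
      · simp
      · intro j' _ h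
        simp [h]
      · simp
  | one => exact ⟨0, 0, by simp [genProd]⟩
  | mul x y _ _ hx hy =>
    obtain ⟨k, e, rfl⟩ := hx
    obtain ⟨l, f, rfl⟩ := hy
    exact ⟨k + l, e + f, (genProd_add k l e f).symm⟩

theorem monomial_genExp_mem (k : ℕ) (e : Fin N → Fin 4 → ℕ) :
    monomial (genExp k e) 1 ∈
      Algebra.adjoin ℂ (leadingMonomials (monLE N) (generators N)) := by
  set T := Algebra.adjoin ℂ (leadingMonomials (monLE N) (generators N))
  -- Exponents of monomials in `T` are closed under addition, so each summand of `genExp k e` can be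
  -- checked separately.
  let E : AddSubmonoid (Fin (2 * N + 1) →₀ ℕ) :=
    { carrier := {α | monomial α 1 ∈ T}
      zero_mem' := T.one_mem
      add_mem' := fun {a b} ha hb => by
        have := T.mul_mem ha hb
        rwa [monomial_mul, one_mul] at this }
  change genExp k e ∈ E
  refine E.add_mem (E.nsmul_mem ?_ k) (E.sum_mem fun i _ => E.sum_mem fun j _ => E.nsmul_mem ?_ _)
  · refine Algebra.subset_adjoin ⟨_, Set.mem_insert _ _, _, ?_, rfl⟩
    rw [mul_one]
    exact isLeadingExponent_X _
  · exact Algebra.subset_adjoin ⟨_, Set.mem_insert_of_mem _ ⟨(i, j), rfl⟩, _,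
      (isLeadingExponent_X _).mul (isLeadingExponent_theta i j), rfl⟩

end Generators

/-! ### Normal forms and rewriting -/

section NormalForm

variable {N : ℕ}

/-- The exponents of a product of generators that is divisible by none of
`(s θ_{i,1}) (s θ_{i,4})`, `(s θ_{i,1}) (s θ_{i,2})²` and `(s θ_{i,2})³`. -/
def IsNormal (e : Fin N → Fin 4 → ℕ) : Prop :=
  ∀ i, ¬ ![1, 0, 0, 1] ≤ e i ∧ ¬ ![1, 2, 0, 0] ≤ e i ∧ ¬ ![0, 3, 0, 0] ≤ e i

theorem genExp_uIdx (k : ℕ) (e : Fin N → Fin 4 → ℕ) (i : Fin N) :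
    genExp k e (uIdx i) = e i 0 + e i 2 := by
  simp [genExp, thetaExp, Fin.sum_univ_four, Finsupp.single_apply, uIdx_inj,
    (uIdx_ne_vIdx _ _).symm, (uIdx_ne_sIdx _).symm, sum_add_distrib]

theorem genExp_vIdx (k : ℕ) (e : Fin N → Fin 4 → ℕ) (i : Fin N) :
    genExp k e (vIdx i) = e i 1 + 2 * e i 2 + 3 * e i 3 := by
  simp [genExp, thetaExp, Fin.sum_univ_four, Finsupp.single_apply, vIdx_inj,
    uIdx_ne_vIdx, (vIdx_ne_sIdx _).symm, sum_add_distrib]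
  ring

theorem genExp_sIdx (k : ℕ) (e : Fin N → Fin 4 → ℕ) :
    genExp k e (sIdx N) = k + ∑ i, ∑ j, e i j := by
  simp [genExp, thetaExp, Fin.sum_univ_four, uIdx_ne_sIdx, vIdx_ne_sIdx]

/-- For fixed `i`, let `(a, b, c, d) = e i`, `U = a + c` and `V = b + 2c + 3d`. If `a = 0`, then `V
≥ 2U`, `c = U`, and `b ≤ 2` is the residue of `V - 2U` mod 3. If `a ≥ 1`, then `d = 0` and `b ≤ 1`,
so `V < 2U` and `b` is the parity of `V`. Hence `U` and `V` determine `e i`, and the exponent of `s`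
then gives `k`. -/
theorem IsNormal.genExp_injective {k l : ℕ} {e f : Fin N → Fin 4 → ℕ} (he : IsNormal e)
    (hf : IsNormal f) (h : genExp k e = genExp l f) : k = l ∧ e = f := by
  have hef : e = f := by
    funext i
    have hu := DFunLike.congr_fun h (uIdx i)
    have hv := DFunLike.congr_fun h (vIdx i)
    have hei := he i
    have hfi := hf i
    simp [Pi.le_def, Fin.forall_fin_succ] at hei hfi
    rw [genExp_uIdx, genExp_uIdx] at hu
    rw [genExp_vIdx, genExp_vIdx] at hv
    have : e i 0 = f i 0 ∧ e i 1 = f i 1 ∧ e i 2 = f i 2 ∧ e i 3 = f i 3 := by omega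
    funext j
    fin_cases j
    exacts [this.1, this.2.1, this.2.2.1, this.2.2.2]
  subst hef
  have hs := DFunLike.congr_fun h (sIdx N)
  rw [genExp_sIdx, genExp_sIdx] at hs
  exact ⟨by omega, rfl⟩

/-- The weight that decreases when a product of generators is rewritten. -/
def genWeight (e : Fin N → Fin 4 → ℕ) : ℕ := ∑ i, ∑ j, ![1, 2, 3, 5] j * e i j

theorem genWeight_add (e f : Fin N → Fin 4 → ℕ) :
    genWeight (e + f) = genWeight e + genWeight f := by
  simp only [genWeight, Pi.add_apply, mul_add, sum_add_distrib]

theorem genWeight_single (i : Fin N) (f : Fin 4 → ℕ) :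
    genWeight (Pi.single i f) = ∑ j, ![1, 2, 3, 5] j * f j := by
  rw [genWeight, sum_eq_single i]
  · simp
  · intro i' _ h
    simp [h]
  · simp

theorem genProd_swap (k : ℕ) (e : Fin N → Fin 4 → ℕ) (i : Fin N) :
    genProd k (e + Pi.single i ![1, 0, 0, 1]) = genProd k (e + Pi.single i ![0, 1, 1, 0]) := by
  -- The power of `s` stays with the common factor `genProd k e`, leaving an identity in `u_i`,
  -- `v_i` and `s`.
  rw [← add_zero k, genProd_add, genProd_add, genProd_single, genProd_single]
  refine congrArg (genProd k e * ·) ?_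
  simp [Fin.prod_univ_four, theta]
  ring

theorem genProd_one_two (k : ℕ) (e : Fin N → Fin 4 → ℕ) (i : Fin N) :
    genProd k (e + Pi.single i ![1, 2, 0, 0]) =
      genProd (k + 2) (e + Pi.single i ![0, 0, 1, 0]) -
        genProd k (e + Pi.single i ![3, 0, 0, 0]) := by
  rw [genProd_add k 2, ← add_zero k, genProd_add, genProd_add, genProd_single, genProd_single,
    genProd_single]
  simp [Fin.prod_univ_four, theta]
  ring

theorem genProd_zero_three (k : ℕ) (e : Fin N → Fin 4 → ℕ) (i : Fin N) :
    genProd k (e + Pi.single i ![0, 3, 0, 0]) =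
      genProd (k + 2) (e + Pi.single i ![0, 0, 0, 1]) -
        genProd k (e + Pi.single i ![2, 1, 0, 0]) := by
  rw [genProd_add k 2, ← add_zero k, genProd_add, genProd_add, genProd_single, genProd_single,
    genProd_single]
  simp [Fin.prod_univ_four, theta]
  ring

theorem sub_add_single_of_le {e : Fin N → Fin 4 → ℕ} {i : Fin N} {f : Fin 4 → ℕ} (h : f ≤ e i) :
    e - Pi.single i f + Pi.single i f = e := by
  refine tsub_add_cancel_of_le fun i' => ?_
  by_cases hi : i' = i
  · subst hi; simpa using h
  · simp [hi]

/-- The normal products of generators. -/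
noncomputable def normalProd (x : ℕ × {e : Fin N → Fin 4 → ℕ // IsNormal e}) : PolyRing N :=
  genProd x.1 x.2.1

/-- Rewriting terminates: the three relations lower the weight from 6 to 5, from 5 to 3 and 3, and
from 6 to 5 and 4. The new factors `s θ_0` carry no weight. -/
theorem genProd_mem_span_normal (k : ℕ) (e : Fin N → Fin 4 → ℕ) :
    genProd k e ∈ Submodule.span ℂ (Set.range (normalProd (N := N))) := by
  induction hn : genWeight e using Nat.strong_induction_on generalizing k e with
  | _ n ih =>
  by_cases he : IsNormal e
  · exact Submodule.subset_span ⟨(k, ⟨e, he⟩), rfl⟩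
  · simp only [IsNormal, not_forall, not_and_or, not_not] at he
    obtain ⟨i, h | h | h⟩ := he
    all_goals
      rw [← sub_add_single_of_le h] at hn ⊢
      rw [genWeight_add, genWeight_single] at hn
      simp [Fin.sum_univ_four] at hn
      first
        | rw [genProd_swap]
        | (first | rw [genProd_one_two] | rw [genProd_zero_three]
           refine Submodule.sub_mem _ ?_ ?_)
    all_goals
      refine ih _ ?_ _ _ rfl
    all_goals
      rw [genWeight_add, genWeight_single]
      simp [Fin.sum_univ_four]
      omega

theorem toSubmodule_Sphi_le_span_normal (N : ℕ) :
    Subalgebra.toSubmodule (Sphi N) ≤ Submodule.span ℂ (Set.range (normalProd (N := N))) := by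
  rw [Sphi, Algebra.adjoin_eq_span, Submodule.span_le]
  intro q hq
  obtain ⟨k, e, rfl⟩ := exists_eq_genProd hq
  exact genProd_mem_span_normal k e

theorem exists_eq_genExp_of_mem_Sphi {p : PolyRing N} (hp : p ∈ Sphi N)
    {α : Fin (2 * N + 1) →₀ ℕ} (hα : IsLeadingExponent (monLE N) p α) :
    ∃ k e, α = genExp k e := by
  obtain ⟨x, hx⟩ := exists_eq_of_mem_span (f := normalProd)
    (a := fun x => genExp x.1 x.2.1) (fun x => isLeadingExponent_genProd x.1 x.2.1)
    (fun x y hxy => by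
      obtain ⟨h₁, h₂⟩ := x.2.2.genExp_injective y.2.2 hxy
      exact Prod.ext h₁ (Subtype.ext h₂))
    (toSubmodule_Sphi_le_span_normal N ((Subalgebra.mem_toSubmodule _).2 hp)) hα
  exact ⟨_, _, hx⟩

end NormalForm

end Oscillator

open Oscillator in
theorem mainTheorem5 (N : ℕ) :
    Oscillator.IsKhovanskiiBasis (Oscillator.monLE N) (Oscillator.generators N)
      (Oscillator.Sphi N) := by
  have hB : generators N ⊆ Sphi N := Algebra.subset_adjoin
  refine ⟨hB, le_antisymm (adjoin_leadingMonomials_le _ hB) ?_⟩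
  rw [initialAlgebra, Submodule.span_le]
  rintro m ⟨p, hp, α, hα, hm⟩
  obtain ⟨k, e, rfl⟩ := exists_eq_genExp_of_mem_Sphi hp hα
  rw [hm]
  exact monomial_genExp_mem k e
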